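/- Let $V$ be Thompson's group $V$, let $S = V * V = P_1 * P_2$ be the free product of two copies of $V$, and for every prime $p$ fix an element $u_p \in P_1 = V$ of order $p$ (such elements exist). For $u \in P_1$ let $\phi_u \in \mathrm{Aut}(S)$ be the partial conjugation by $u$, i.e. the automorphism with $\phi_u(x) = x$ for $x \in P_1$ and $\phi_u(x) = u x u^{-1}$ for $x \in P_2$. For a strictly increasing infinite sequence of primes $\omega = (s_1, s_2, s_3, \dots)$ and $n \ge 0$ let $$G_{(\omega,n)} = (\underbrace{S \times \cdots \times S}_{n}) \rtimes_{\phi_{(\omega,n)}} \mathbb{Z},$$ where the generator of $\mathbb{Z}$ acts by $\phi_{(\omega,n)}(x_1,\dots,x_n) = (\phi_{u_{s_1}}(x_1), \dots, \phi_{u_{s_n}}(x_n))$, and let $\alpha_n : G_{(\omega,n+1)} \to G_{(\omega,n)}$ be the homomorphism that kills the last copy of $S$ and is the identity on the other copies of $S$ and on $\mathbb{Z}$. Two inverse sequences of groups $(G_n, \alpha_n)$ and $(H_n, \beta_n)$ (with $\alpha_n : G_{n+1} \to G_n$ and $\beta_n : H_{n+1} \to H_n$) are called pro-isomorphic if there are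 strictly increasing sequences of indices $(i_k)_{k\ge 0}$ and $(j_k)_{k \ge 0}$ and homomorphisms $f_k : H_{j_k} \to G_{i_k}$ and $g_k : G_{i_{k+1}} \to H_{j_k}$ such that, for all $k$, $f_k \circ g_k$ is the composite bonding map $G_{i_{k+1}} \to G_{i_k}$ and $g_k \circ f_{k+1}$ is the composite bonding map $H_{j_{k+1}} \to H_{j_k}$. If $\omega \ne \eta$ are two distinct strictly increasing sequences of primes, then the inverse sequences $(G_{(\omega,n)}, \alpha_n)_{n \ge 0}$ and $(G_{(\eta,n)}, \alpha_n)_{n \ge 0}$ are not pro-isomorphic. -/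

import Mathlib

open scoped Monoid.Coprod

/-- A permutation `f` of the Cantor space of infinite binary sequences is a *prefix replacement*
if, for some `n`, it replaces each finite prefix `w` of length `n` by some finite word `v`
(depending on `w`, of arbitrary length) and leaves the remaining tail unchanged. As `f` is a
bijection, the cones over these words `v` partition the Cantor space, so that `f` is given by
a bijection between two finite complete prefix codes (equivalently, by a pair of finite binary
trees with a bijection between their leaves). -/
def IsPrefixReplacement (f : Equiv.Perm (Stream' Bool)) : Prop :=
  ∃ n : ℕ, ∀ w : List Bool, w.length = n → ∃ v : List Bool, ∀ x : Stream' Bool,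
    f (w ++ₛ x) = v ++ₛ x

theorem IsPrefixReplacement.mul {f g : Equiv.Perm (Stream' Bool)}
    (hf : IsPrefixReplacement f) (hg : IsPrefixReplacement g) : IsPrefixReplacement (f * g) := by
  obtain ⟨m, hm⟩ := hf
  obtain ⟨n, hn⟩ := hg
  refine ⟨n + m, fun w hw => ?_⟩
  obtain ⟨v, hv⟩ := hn (w.take n) (by simp; omega)
  obtain ⟨r, hr⟩ := hm ((v ++ w.drop n).take m) (by simp; omega)
  refine ⟨r ++ (v ++ w.drop n).drop m, fun x => ?_⟩
  have h1 : w ++ₛ x = w.take n ++ₛ (w.drop n ++ₛ x) := by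
    rw [← Stream'.append_append_stream, List.take_append_drop]
  have h2 : v ++ₛ (w.drop n ++ₛ x) =
      (v ++ w.drop n).take m ++ₛ ((v ++ w.drop n).drop m ++ₛ x) := by
    rw [← Stream'.append_append_stream, ← Stream'.append_append_stream, List.take_append_drop]
  rw [Equiv.Perm.mul_apply, h1, hv, h2, hr, Stream'.append_append_stream]

theorem IsPrefixReplacement.inv {f : Equiv.Perm (Stream' Bool)}
    (hf : IsPrefixReplacement f) : IsPrefixReplacement f⁻¹ := by
  obtain ⟨n, hn⟩ := hf
  choose! v hv using hn
  obtain ⟨N, hN⟩ : ∃ N : ℕ, ∀ w : List Bool, w.length = n → (v w).length ≤ N := by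
    obtain ⟨N, hN⟩ := ((List.finite_length_eq Bool n).image fun w => (v w).length).bddAbove
    exact ⟨N, fun w hw => hN ⟨w, hw, rfl⟩⟩
  refine ⟨N, fun w hw => ?_⟩
  obtain ⟨y, hy⟩ : ∃ y, f y = w ++ₛ Stream'.const true := f.surjective _
  have hl : (y.take n).length = n := Stream'.length_take n y
  rw [← Stream'.append_take_drop n y, hv _ hl] at hy
  have hpre : w = v (y.take n) ++ w.drop (v (y.take n)).length := by
    have h := congrArg (Stream'.take (v (y.take n)).length) hy
    have h3 : (v (y.take n)).length ≤ w.length := hw ▸ hN _ hl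
    rw [Stream'.take_append_of_le_length _ _ _ le_rfl,
      Stream'.take_append_of_le_length _ _ _ h3, List.take_length] at h
    conv_lhs => rw [← List.take_append_drop (v (y.take n)).length w, ← h]
  refine ⟨y.take n ++ w.drop (v (y.take n)).length, fun x => ?_⟩
  rw [Equiv.Perm.inv_eq_iff_eq, Stream'.append_append_stream, hv _ hl,
    ← Stream'.append_append_stream, ← hpre]

/-- Thompson's group `V`, as the group of prefix replacements of the Cantor space. -/
def ThompsonV : Subgroup (Equiv.Perm (Stream' Bool)) where
  carrier := {f | IsPrefixReplacement f}
  one_mem' := ⟨0, fun w _ => ⟨w, fun _ => rfl⟩⟩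
  mul_mem' := IsPrefixReplacement.mul
  inv_mem' := IsPrefixReplacement.inv

/-- Splitting an infinite binary sequence into its prefix of length `n` and its tail. -/
def prefixEquiv (n : ℕ) : Stream' Bool ≃ List.Vector Bool n × Stream' Bool where
  toFun x := (⟨x.take n, Stream'.length_take n x⟩, x.drop n)
  invFun q := q.1.toList ++ₛ q.2
  left_inv x := Stream'.append_take_drop n x
  right_inv q := by
    obtain ⟨⟨w, rfl⟩, x⟩ := q
    refine Prod.ext (Subtype.ext ?_) (Stream'.drop_append_stream w x)
    exact (Stream'.take_append_of_le_length _ _ _ le_rfl).trans (List.take_length)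

/-- `V` has elements of every prime order: permutations of the prefixes of a fixed length. -/
theorem ThompsonV.exists_orderOf_eq (p : Nat.Primes) : ∃ v : ThompsonV, orderOf v = p := by
  have : Fact (p : ℕ).Prime := ⟨p.2⟩
  have hcard : (p : ℕ) ∣ Fintype.card (Equiv.Perm (List.Vector Bool p)) := by
    rw [Fintype.card_perm, card_vector, Fintype.card_bool]
    exact Nat.dvd_factorial p.2.pos Nat.lt_two_pow_self.le
  obtain ⟨σ, hσ⟩ := exists_prime_orderOf_dvd_card (p : ℕ) hcard
  let F : Equiv.Perm (List.Vector Bool p) →* Equiv.Perm (Stream' Bool) :=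
    { toFun := fun τ => (prefixEquiv p).symm.permCongr (Equiv.prodCongr τ (Equiv.refl _))
      map_one' := by ext1 x; exact (prefixEquiv p).symm_apply_apply x
      map_mul' := fun a b => by ext1 x; simp [Equiv.permCongr_apply]; rfl }
  have hF : ∀ τ w x, F τ ((prefixEquiv p).symm (w, x)) = (prefixEquiv p).symm (τ w, x) := by
    intro τ w x
    simp [F, Equiv.permCongr_apply]
  have hinj : Function.Injective F := by
    intro a b hab
    ext1 w
    have h := hF a w (Stream'.const true)
    rw [hab, hF b] at h
    exact (congrArg Prod.fst ((prefixEquiv p).symm.injective h)).symm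
  refine ⟨⟨F σ, p, fun w hw => ⟨(σ ⟨w, hw⟩).toList, fun x => hF σ ⟨w, hw⟩ x⟩⟩, ?_⟩
  rw [← orderOf_injective ThompsonV.subtype ThompsonV.subtype_injective]
  exact (orderOf_injective F hinj σ).trans hσ

/-- The endomorphism of the free product `P ∗ Q` that is the identity on `P` and conjugation
`q ↦ u q u⁻¹` on `Q`, where `u ∈ P`. -/
def partialConjHom {P Q : Type*} [Group P] [Group Q] (u : P) : P ∗ Q →* P ∗ Q :=
  Monoid.Coprod.lift Monoid.Coprod.inl
    ((MulAut.conj (Monoid.Coprod.inl u : P ∗ Q)).toMonoidHom.comp Monoid.Coprod.inr)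

theorem partialConjHom_comp {P Q : Type*} [Group P] [Group Q] (u v : P) :
    (partialConjHom u).comp (partialConjHom v) = (partialConjHom (v * u) : P ∗ Q →* P ∗ Q) := by
  ext x <;> simp [partialConjHom, mul_assoc]

theorem partialConjHom_one {P Q : Type*} [Group P] [Group Q] :
    partialConjHom (1 : P) = MonoidHom.id (P ∗ Q) := by
  ext x <;> simp [partialConjHom]

/-- The partial conjugation `φ_u`, as an automorphism of the free product `P ∗ Q`. -/
def partialConj {P Q : Type*} [Group P] [Group Q] (u : P) : MulAut (P ∗ Q) :=
  (partialConjHom u).toMulEquiv (partialConjHom u⁻¹)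
    (by rw [partialConjHom_comp, mul_inv_cancel, partialConjHom_one])
    (by rw [partialConjHom_comp, inv_mul_cancel, partialConjHom_one])

/-- The free product `S = V ∗ V`. -/
abbrev GroupS : Type := ThompsonV ∗ ThompsonV

/-- The automorphism of `S × ⋯ × S` (`n` factors) that is the partial conjugation by `u (ω i)`
on the `i`-th factor. -/
def prodPartialConj (u : Nat.Primes → ThompsonV) (ω : ℕ → Nat.Primes) (n : ℕ) :
    MulAut (Fin n → GroupS) :=
  MulEquiv.piCongrRight fun i : Fin n => partialConj (u (ω i))

/-- The group `G_(ω,n) = (S × ⋯ × S) ⋊ ℤ`, where the generator of `ℤ` acts by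
`prodPartialConj u ω n`. -/
abbrev LadderGroup (u : Nat.Primes → ThompsonV) (ω : ℕ → Nat.Primes) (n : ℕ) : Type :=
  (Fin n → GroupS) ⋊[zpowersHom _ (prodPartialConj u ω n)] Multiplicative ℤ

/-- The projection of `S × ⋯ × S` (`n + 1` factors) onto its first `n` factors. -/
def forgetLast (n : ℕ) : (Fin (n + 1) → GroupS) →* (Fin n → GroupS) where
  toFun x := fun i => x i.castSucc
  map_one' := rfl
  map_mul' _ _ := rfl

theorem forgetLast_zpow (u : Nat.Primes → ThompsonV) (ω : ℕ → Nat.Primes) (n : ℕ) (k : ℤ)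
    (x : Fin (n + 1) → GroupS) :
    forgetLast n ((prodPartialConj u ω (n + 1) ^ k) x) =
      (prodPartialConj u ω n ^ k) (forgetLast n x) := by
  induction k using Int.induction_on generalizing x with
  | zero => rfl
  | succ k ih => rw [zpow_add_one, zpow_add_one, MulAut.mul_apply, MulAut.mul_apply, ih]; rfl
  | pred k ih => rw [zpow_sub_one, zpow_sub_one, MulAut.mul_apply, MulAut.mul_apply, ih]; rfl

/-- The bonding map `G_(ω,n+1) → G_(ω,n)` that crushes out the last copy of `S` and is the
identity on the other copies of `S` and on `ℤ`. -/
def ladderBond (u : Nat.Primes → ThompsonV) (ω : ℕ → Nat.Primes) (n : ℕ) :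
    LadderGroup u ω (n + 1) →* LadderGroup u ω n :=
  SemidirectProduct.map (forgetLast n) (MonoidHom.id _) fun g =>
    MonoidHom.ext fun x => forgetLast_zpow u ω n g.toAdd x

/-- The composite `G n → G m` of the bonding maps of an inverse sequence
`G 0 ← G 1 ← G 2 ← ⋯`, for `m ≤ n`. -/
def bondComp {G : ℕ → Type*} [∀ n, Group (G n)] (α : ∀ n, G (n + 1) →* G n) {m n : ℕ}
    (h : m ≤ n) : G n →* G m :=
  Nat.leRec (motive := fun k _ => G k →* G m) (MonoidHom.id (G m))
    (fun k _ f => f.comp (α k)) h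

/-- Two inverse sequences of groups `(G, α)` and `(H, β)` are *pro-isomorphic* if subsequences
`G (i 0), G (i 1), …` and `H (j 0), H (j 1), …` fit into a commuting ladder with diagonal maps
`f k : H (j k) → G (i k)` and `g k : G (i (k + 1)) → H (j k)`. -/
def ProIsomorphic {G H : ℕ → Type*} [∀ n, Group (G n)] [∀ n, Group (H n)]
    (α : ∀ n, G (n + 1) →* G n) (β : ∀ n, H (n + 1) →* H n) : Prop :=
  ∃ (i j : ℕ → ℕ) (hi : StrictMono i) (hj : StrictMono j)
    (f : ∀ k, H (j k) →* G (i k)) (g : ∀ k, G (i (k + 1)) →* H (j k)),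
    (∀ k, (f k).comp (g k) = bondComp α (hi.monotone k.le_succ)) ∧
    (∀ k, (g k).comp (f (k + 1)) = bondComp β (hj.monotone k.le_succ))

/-! The bonding maps are onto, so every diagonal map of a pro-isomorphism is onto. It therefore
suffices that a surjection `f : G_(η,m) → G_(ω,n)` forces every prime `ω a`, `a < n`, to occur among
the first `m` terms of `η` (`exists_prime_eq_of_surjective`); the two sequences then have the same
range, and being increasing they agree.

Every homomorphism `V → ℤ` is trivial (`ThompsonV.hom_int_eq_one`), so `f` carries `S^m` into `S^n`
and multiplies the `ℤ`-coordinate by some `e = ±1`. Coordinate `a` of `f` is then a surjection `F :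
S^m → S`. Since `S` is not a product of two commuting nontrivial normal subgroups, `F` depends on a
single coordinate `b` (`exists_factor_of_surjective`). With `q = η b`, the `q`-th power of the
generator of `ℤ` acts trivially on coordinate `b`; its image under `f` shows that partial
conjugation by `u (ω a) ^ (e * q)` is inner. As `V` is centreless, this power is trivial
(`eq_one_of_partialConj_inner`), so `ω a` divides `q` and the two primes coincide. -/

/-! ### Conjugation into a factor of a free product -/

theorem Monoid.CoprodI.mem_range_of_conj {ι : Type*} {M : ι → Type*} [∀ i, Group (M i)] {i : ι}
    {p p' : M i} (hp : p ≠ 1) {t : Monoid.CoprodI M}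
    (h : t⁻¹ * Monoid.CoprodI.of p * t = Monoid.CoprodI.of p') :
    t ∈ (Monoid.CoprodI.of : M i →* Monoid.CoprodI M).range := by
  classical
  set w := Word.equiv t with hw
  have hwt : w.prod = t := Word.equiv.symm_apply_apply t
  set r := Word.equivPair i w with hr
  have hrw : Word.rcons r = w := (Word.equivPair i).symm_apply_apply w
  have ht : t = of r.head * r.tail.prod := by rw [← Word.prod_rcons, hrw, hwt]
  by_cases he : r.tail = Word.empty
  · exact ⟨r.head, by rw [ht, he, Word.prod_empty, mul_one]⟩
  exfalso
  obtain ⟨k, l, w', hw'⟩ := NeWord.of_word r.tail he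
  have hk : k ≠ i := by
    rintro rfl
    refine r.fstIdx_ne ?_
    rw [← hw', Word.fstIdx]
    change Option.map Sigma.fst w'.toList.head? = _
    rw [NeWord.toList_head?]
    rfl
  have hc : r.head⁻¹ * p * r.head ≠ 1 := fun hc => hp <| by
    have : p = r.head * (r.head⁻¹ * p * r.head) * r.head⁻¹ := by group
    rw [this, hc]; group
  have hp' : p' ≠ 1 := by
    rintro rfl
    rw [map_one] at h
    apply hp
    apply of_injective (M := M) i
    rw [map_one]
    have : of p = t * (t⁻¹ * of p * t) * t⁻¹ := by group
    rw [this, h]; group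
  -- With `t = head * tail` and the tail not starting in `M i`, this is the reduced form of `t⁻¹ p
  -- t`. Its length is at least 3, whereas `p'` has length 1.
  let W := ((w'.inv).append hk (NeWord.singleton (r.head⁻¹ * p * r.head) hc)).append hk.symm w'
  have hW : W.prod = of p' := by
    rw [← h, ht, NeWord.append_prod, NeWord.append_prod, NeWord.inv_prod, NeWord.prod_singleton]
    have : w'.prod = r.tail.prod := by rw [← hw']; rfl
    rw [this]
    simp [mul_assoc]
  have hWW : W.toWord = (NeWord.singleton p' hp').toWord := by
    apply Word.equiv.symm.injective
    change W.prod = (NeWord.singleton p' hp').prod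
    rw [hW, NeWord.prod_singleton]
  have hl := congrArg (fun x => x.toList.length) hWW
  simp only [NeWord.toWord, W, NeWord.toList, List.length_append, List.length_singleton] at hl
  have := List.length_pos_iff.2 w'.toList_ne_nil
  omega

/-- The free product of two copies of `G` is an indexed free product over `Bool`. -/
def coprodEquivCoprodI (G : Type*) [Group G] : G ∗ G ≃* Monoid.CoprodI fun _ : Bool => G :=
  MonoidHom.toMulEquiv
    (Monoid.Coprod.lift (Monoid.CoprodI.of (M := fun _ : Bool => G) (i := true))
      (Monoid.CoprodI.of (M := fun _ : Bool => G) (i := false)))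
    (Monoid.CoprodI.lift fun b => if b then Monoid.Coprod.inl else Monoid.Coprod.inr)
    (by ext x <;> simp) (by ext b x; cases b <;> simp)

/-! ### Normal subgroups and partial conjugations of `G ∗ G` -/

section Coprod

variable {G : Type*} [Group G]

open Monoid.Coprod

theorem mem_range_inl_of_conj {p p' : G} (hp : p ≠ 1) {t : G ∗ G}
    (h : t⁻¹ * inl p * t = inl p') : t ∈ (inl : G →* G ∗ G).range := by
  have h' := congrArg (coprodEquivCoprodI G) h
  simp only [map_mul, map_inv] at h'
  obtain ⟨g, hg⟩ := Monoid.CoprodI.mem_range_of_conj (M := fun _ : Bool => G) (i := true) hp h'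
  exact ⟨g, (coprodEquivCoprodI G).injective hg⟩

theorem mem_range_inr_of_conj {p p' : G} (hp : p ≠ 1) {t : G ∗ G}
    (h : t⁻¹ * inr p * t = inr p') : t ∈ (inr : G →* G ∗ G).range := by
  obtain ⟨g, hg⟩ := mem_range_inl_of_conj (t := swap G G t) hp
    (by simpa using congrArg (swap G G) h)
  exact ⟨g, swap_injective (by simpa using hg)⟩

theorem inl_ne_inr {p q : G} (hp : p ≠ 1) : (inl p : G ∗ G) ≠ inr q := fun h => by
  have := congrArg fst h
  simp at this
  exact hp this

/-- A normal subgroup of a free product that is contained in a factor is trivial. -/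
theorem eq_bot_of_normal_of_le_range_inl [Nontrivial G] {M : Subgroup (G ∗ G)} [hM : M.Normal]
    (h : M ≤ (inl : G →* G ∗ G).range) : M = ⊥ := by
  rw [Subgroup.eq_bot_iff_forall]
  intro x hx
  obtain ⟨p, rfl⟩ := h hx
  by_contra hne
  have hp : p ≠ 1 := fun h => hne (by rw [h, map_one])
  obtain ⟨q, hq⟩ := exists_ne (1 : G)
  -- Conjugating by `inr q` keeps `inl p` in the first factor, which would put `inr q` there too.
  obtain ⟨p', hp'⟩ := h (hM.conj_mem _ hx (inr q)⁻¹)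
  obtain ⟨g, hg⟩ := mem_range_inl_of_conj (t := inr q) hp (by rw [hp', inv_inv])
  by_cases hg1 : g = 1
  · subst hg1
    rw [map_one] at hg
    exact hq (inr_injective (hg.symm.trans (map_one _).symm))
  · exact inl_ne_inr hg1 hg

theorem mem_range_inl_of_commute {p : G} (hp : p ≠ 1) {t : G ∗ G} (h : Commute t (inl p)) :
    t ∈ (inl : G →* G ∗ G).range :=
  mem_range_inl_of_conj hp (p' := p) (by rw [mul_assoc, ← h.eq, inv_mul_cancel_left])

theorem mem_range_inr_of_commute {p : G} (hp : p ≠ 1) {t : G ∗ G} (h : Commute t (inr p)) :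
    t ∈ (inr : G →* G ∗ G).range :=
  mem_range_inr_of_conj hp (p' := p) (by rw [mul_assoc, ← h.eq, inv_mul_cancel_left])

/-- A free product of two copies of a nontrivial group is not generated by two commuting
nontrivial normal subgroups. -/
theorem eq_bot_or_eq_bot_of_commute [Nontrivial G] {N M : Subgroup (G ∗ G)} [N.Normal] [M.Normal]
    (hc : ∀ n ∈ N, ∀ m ∈ M, Commute n m) (hs : ∀ s, ∃ n ∈ N, ∃ m ∈ M, s = n * m) :
    N = ⊥ ∨ M = ⊥ := by
  have key : ∀ {A B : Subgroup (G ∗ G)} [B.Normal], (∀ a ∈ A, ∀ b ∈ B, Commute a b) →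
      ∀ g : G, g ≠ 1 → inl g ∈ A → B = ⊥ := fun {A B} _ hAB g hg hgA =>
    eq_bot_of_normal_of_le_range_inl fun b hb =>
      mem_range_inl_of_commute hg (hAB _ hgA b hb).symm
  obtain ⟨p, hp⟩ := exists_ne (1 : G)
  obtain ⟨n, hn, m, hm, hnm⟩ := hs (inl p)
  -- Since `n` commutes with `m` and with itself, it commutes with `inl p = n * m` and so lies in
  -- the first factor. Hence `N` or `M` contains a nontrivial `inl g`, and `key` kills the other.
  have hcn : Commute n (inl p) := by
    rw [hnm]; exact (Commute.refl n).mul_right (hc n hn m hm)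
  obtain ⟨g, rfl⟩ := mem_range_inl_of_commute hp hcn
  by_cases hg : g = 1
  · subst hg
    rw [map_one, one_mul] at hnm
    exact Or.inl (key (fun m hm n hn => (hc n hn m hm).symm) p hp (hnm ▸ hm))
  · exact Or.inr (key hc g hg hn)

theorem partialConj_inl (u x : G) : partialConj u (inl x : G ∗ G) = inl x := rfl

theorem partialConj_inr (u x : G) :
    partialConj u (inr x : G ∗ G) = inl u * inr x * (inl u)⁻¹ := rfl

/-- `partialConj v` fixes `inl u`, so it inserts `v` inside the conjugation by `u`. This reversal of
order is why `partialConjInvHom` uses inverses. -/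
theorem partialConj_mul (u v : G) :
    (partialConj (u * v) : MulAut (G ∗ G)) = partialConj v * partialConj u := by
  ext x
  exact (DFunLike.congr_fun (partialConjHom_comp v u) x).symm

/-- Partial conjugation as a homomorphism to the automorphism group. -/
def partialConjInvHom (G : Type*) [Group G] : G →* MulAut (G ∗ G) :=
  MonoidHom.mk' (fun u => partialConj u⁻¹) fun u v => by rw [mul_inv_rev, partialConj_mul]

theorem partialConj_zpow (u : G) (k : ℤ) :
    (partialConj u : MulAut (G ∗ G)) ^ k = partialConj (u ^ k) := by
  have h : ∀ v : G, (partialConj v : MulAut (G ∗ G)) = partialConjInvHom G v⁻¹ := fun v => by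
    simp [partialConjInvHom]
  rw [h, h, ← map_zpow, inv_zpow]

/-- If the centre of `G` is trivial then a partial conjugation is inner only if it is trivial. -/
theorem eq_one_of_partialConj_inner [Nontrivial G] (hZ : Subgroup.center G = ⊥) {u : G}
    {s : G ∗ G} (h : ∀ x, partialConj u x = s * x * s⁻¹) : u = 1 := by
  -- The conjugator `s` centralizes the first factor, hence is `inl g` with `g` central, so `s = 1`;
  -- then `inl u` commutes with `inr q`.
  have hc : ∀ p : G, Commute s (inl p) := fun p => by
    have := h (inl p)
    rw [partialConj_inl, eq_mul_inv_iff_mul_eq] at this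
    exact this.symm
  obtain ⟨q, hq⟩ := exists_ne (1 : G)
  obtain ⟨g, rfl⟩ := mem_range_inl_of_commute hq (hc q)
  have hgZ : g ∈ Subgroup.center G := Subgroup.mem_center_iff.2 fun p =>
    inl_injective (N := G) (by rw [map_mul, map_mul]; exact (hc p).eq.symm)
  rw [hZ, Subgroup.mem_bot] at hgZ
  subst hgZ
  have hu : Commute (inl u : G ∗ G) (inr q) := by
    have := h (inr q)
    rw [partialConj_inr, map_one, one_mul, inv_one, mul_one, mul_inv_eq_iff_eq_mul] at this
    exact this
  obtain ⟨g, hg⟩ := mem_range_inr_of_commute hq hu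
  by_contra hne
  exact inl_ne_inr hne hg.symm

end Coprod

/-! ### Cone exchanges and the trivial centre of `V` -/

namespace ThompsonV

theorem prefix_or_prefix_of_append_eq {a b : List Bool} {x y : Stream' Bool}
    (h : a ++ₛ x = b ++ₛ y) : (∃ c, b = a ++ c) ∨ ∃ c, a = b ++ c := by
  rcases le_total a.length b.length with hl | hl
  · left
    refine ⟨b.drop a.length, ?_⟩
    have := congrArg (Stream'.take a.length) h
    rw [Stream'.take_append_of_le_length _ _ _ le_rfl, Stream'.take_append_of_le_length _ _ _ hl,
      List.take_length] at this
    exact (List.take_append_drop a.length b).symm.trans (by rw [← this])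
  · right
    refine ⟨a.drop b.length, ?_⟩
    have := congrArg (Stream'.take b.length) h
    rw [Stream'.take_append_of_le_length _ _ _ le_rfl, Stream'.take_append_of_le_length _ _ _ hl,
      List.take_length] at this
    exact (List.take_append_drop b.length a).symm.trans (by rw [this])

theorem take_length_append (a : List Bool) (x : Stream' Bool) : (a ++ₛ x).take a.length = a := by
  rw [Stream'.take_append_of_le_length _ _ _ le_rfl, List.take_length]

theorem take_eq_iff {a : List Bool} {x : Stream' Bool} :
    x.take a.length = a ↔ ∃ y, x = a ++ₛ y := by
  constructor
  · intro h
    exact ⟨x.drop a.length, by conv_rhs => rw [← h, Stream'.length_take, Stream'.append_take_drop]⟩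
  · rintro ⟨y, rfl⟩
    exact take_length_append a y

/-- The map of the Cantor space that exchanges the cones over `a` and `b`. -/
def coneSwapFun (a b : List Bool) (x : Stream' Bool) : Stream' Bool :=
  if x.take a.length = a then b ++ₛ x.drop a.length
  else if x.take b.length = b then a ++ₛ x.drop b.length else x

theorem coneSwapFun_left (a b : List Bool) (x : Stream' Bool) :
    coneSwapFun a b (a ++ₛ x) = b ++ₛ x := by
  rw [coneSwapFun, if_pos (take_length_append a x), Stream'.drop_append_stream]

theorem coneSwapFun_right {a b : List Bool} (h : ∀ x y, a ++ₛ x ≠ b ++ₛ y) (x : Stream' Bool) :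
    coneSwapFun a b (b ++ₛ x) = a ++ₛ x := by
  rw [coneSwapFun, if_neg, if_pos (take_length_append b x), Stream'.drop_append_stream]
  rw [take_eq_iff]
  rintro ⟨y, hy⟩
  exact h y x hy.symm

theorem coneSwapFun_of_notMem {a b : List Bool} {x : Stream' Bool} (ha : ∀ y, x ≠ a ++ₛ y)
    (hb : ∀ y, x ≠ b ++ₛ y) : coneSwapFun a b x = x := by
  rw [coneSwapFun, if_neg, if_neg]
  · rw [take_eq_iff]; rintro ⟨y, hy⟩; exact hb y hy
  · rw [take_eq_iff]; rintro ⟨y, hy⟩; exact ha y hy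

theorem coneSwapFun_involutive {a b : List Bool} (h : ∀ x y, a ++ₛ x ≠ b ++ₛ y) :
    Function.Involutive (coneSwapFun a b) := by
  intro x
  by_cases ha : ∃ y, x = a ++ₛ y
  · obtain ⟨y, rfl⟩ := ha
    rw [coneSwapFun_left, coneSwapFun_right h]
  by_cases hb : ∃ y, x = b ++ₛ y
  · obtain ⟨y, rfl⟩ := hb
    rw [coneSwapFun_right h, coneSwapFun_left]
  push Not at ha hb
  rw [coneSwapFun_of_notMem ha hb, coneSwapFun_of_notMem ha hb]

/-- The element of `V` that exchanges two disjoint cones. -/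
def coneSwap (a b : List Bool) (h : ∀ x y, a ++ₛ x ≠ b ++ₛ y) : ThompsonV :=
  -- At this depth every cone lies inside one of the two exchanged cones or misses both.
  ⟨(coneSwapFun_involutive h).toPerm, a.length + b.length, fun w hw => by
    have hx : ∀ c : List Bool, c.length ≤ w.length → ∀ x y, w ++ₛ x = c ++ₛ y →
        ∃ d, w = c ++ d := by
      intro c hc x y he
      rcases prefix_or_prefix_of_append_eq he with ⟨d, hd⟩ | hd
      · have : d = [] := by
          have := congrArg List.length hd
          rw [List.length_append] at this
          exact List.length_eq_zero_iff.1 (by omega)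
        exact ⟨[], by rw [hd, this]; simp⟩
      · exact hd
    by_cases ha : ∃ c, w = a ++ c
    · obtain ⟨c, rfl⟩ := ha
      exact ⟨b ++ c, fun x => by
        rw [Stream'.append_append_stream, Stream'.append_append_stream]
        exact coneSwapFun_left a b _⟩
    by_cases hb : ∃ c, w = b ++ c
    · obtain ⟨c, rfl⟩ := hb
      exact ⟨a ++ c, fun x => by
        rw [Stream'.append_append_stream, Stream'.append_append_stream]
        exact coneSwapFun_right h _⟩
    exact ⟨w, fun x => coneSwapFun_of_notMem (fun y hy => ha (hx a (by omega) x y hy))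
      fun y hy => hb (hx b (by omega) x y hy)⟩⟩

theorem coneSwap_mul_self (a b : List Bool) (h : ∀ x y, a ++ₛ x ≠ b ++ₛ y) :
    coneSwap a b h * coneSwap a b h = 1 :=
  Subtype.ext (Equiv.ext (coneSwapFun_involutive h))

theorem append_cons_ne {a c d : List Bool} {b : Bool} {x y : Stream' Bool} :
    a ++ b :: c ++ₛ x ≠ a ++ (!b) :: d ++ₛ y := by
  intro h
  rw [Stream'.append_append_stream, Stream'.append_append_stream, Stream'.append_right_inj] at h
  have := congrArg Stream'.head h
  rw [Stream'.cons_append_stream, Stream'.cons_append_stream, Stream'.head_cons,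
    Stream'.head_cons] at this
  cases b <;> simp at this

/-- If `f` moves `x` to `y ≠ x`, exchanging two small cones inside a neighbourhood of `y` that omits
`x` fixes `x` but moves `y`, so it does not commute with `f`. -/
theorem center_eq_bot : Subgroup.center ThompsonV = ⊥ := by
  rw [Subgroup.eq_bot_iff_forall]
  intro f hf
  rw [Subgroup.mem_center_iff] at hf
  refine Subtype.ext (Equiv.ext fun x => ?_)
  change (f : Equiv.Perm (Stream' Bool)) x = x
  by_contra hne
  set y := (f : Equiv.Perm (Stream' Bool)) x with hy
  obtain ⟨n, hn⟩ : ∃ n, y.take n ≠ x.take n := by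
    by_contra! h
    exact hne (Stream'.take_theorem _ _ h)
  have hd : ∀ s t, (y.take n ++ [y.get n]) ++ₛ s ≠ (y.take n ++ [!y.get n]) ++ₛ t :=
    fun s t => append_cons_ne
  let g := coneSwap _ _ hd
  have hgx : (g : Equiv.Perm (Stream' Bool)) x = x := by
    have : ∀ (b : Bool) (z : Stream' Bool), x ≠ (y.take n ++ [b]) ++ₛ z := by
      intro b z hz
      rw [Stream'.append_append_stream] at hz
      have := congrArg (Stream'.take n) hz
      rw [Stream'.take_append_of_le_length _ _ _ (Stream'.length_take n y).ge,
        List.take_of_length_le (Stream'.length_take n y).le] at this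
      exact hn this.symm
    exact coneSwapFun_of_notMem (this _) (this _)
  have hgy : (g : Equiv.Perm (Stream' Bool)) y ≠ y := by
    intro h
    have h1 : y = (y.take n ++ [y.get n]) ++ₛ y.drop (n + 1) := by
      rw [← Stream'.take_succ', Stream'.append_take_drop]
    have h2 : (g : Equiv.Perm (Stream' Bool)) y = (y.take n ++ [!y.get n]) ++ₛ y.drop (n + 1) := by
      conv_lhs => arg 2; rw [h1]
      exact coneSwapFun_left _ _ _
    exact hd _ _ (h1.symm.trans (h.symm.trans h2))
  have := congrArg (fun k : ThompsonV => (k : Equiv.Perm (Stream' Bool)) x) (hf g)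
  change (g : Equiv.Perm (Stream' Bool)) y = (f : Equiv.Perm (Stream' Bool))
    ((g : Equiv.Perm (Stream' Bool)) x) at this
  rw [hgx] at this
  exact hgy this

/-- `f` replaces every prefix `w` of length `n` by `v w`. -/
def IsTable (f : ThompsonV) {n : ℕ} (v : List.Vector Bool n → List Bool) : Prop :=
  ∀ w x, (f : Equiv.Perm (Stream' Bool)) (w.toList ++ₛ x) = v w ++ₛ x

/-! ### Homomorphisms from `V` to `ℤ` -/

namespace IsTable

variable {f : ThompsonV} {n : ℕ} {v : List.Vector Bool n → List Bool}

theorem exists_eq (h : IsTable f v) (z : Stream' Bool) : ∃ w y, z = v w ++ₛ y := by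
  obtain ⟨t, rfl⟩ := (f : Equiv.Perm (Stream' Bool)).surjective z
  let w : List.Vector Bool n := ⟨t.take n, Stream'.length_take n t⟩
  have ht : w.toList ++ₛ t.drop n = t := Stream'.append_take_drop n t
  exact ⟨w, t.drop n, by rw [← h, ht]⟩

theorem inj (h : IsTable f v) {w w' : List.Vector Bool n} {x y : Stream' Bool}
    (he : v w ++ₛ x = v w' ++ₛ y) : w = w' := by
  rw [← h, ← h] at he
  exact Subtype.ext (Stream'.append_left_injective _ _ _ _
    ((f : Equiv.Perm (Stream' Bool)).injective he) (w.2.trans w'.2.symm))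

/-- If no prefix gets shorter then no prefix gets longer. -/
theorem length_eq_of_le (h : IsTable f v) (hl : ∀ w, n ≤ (v w).length) (w) :
    (v w).length = n := by
  -- Truncation to length `n` is onto because the image cones cover, hence injective. A longer `v w`
  -- would leave a sibling cone to be covered by another word with the same truncation.
  let F : List.Vector Bool n → List.Vector Bool n := fun w =>
    ⟨(v w).take n, by rw [List.length_take, min_eq_left (hl w)]⟩
  have hFs : ∀ (u : List.Vector Bool n) (s : Stream' Bool) w y, u.toList ++ₛ s = v w ++ₛ y →
      F w = u := fun u s w y hu => by
    have := congrArg (Stream'.take n) hu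
    rw [Stream'.take_append_of_le_length _ _ _ u.toList_length.ge, Stream'.take_append_of_le_length _ _ _ (hl w),
      List.take_of_length_le u.toList_length.le] at this
    exact Subtype.ext this.symm
  have hF : Function.Surjective F := fun u => by
    obtain ⟨w, y, hw⟩ := h.exists_eq (u.toList ++ₛ Stream'.const true)
    exact ⟨w, hFs _ _ _ _ hw⟩
  have hFi := Finite.injective_iff_surjective.2 hF
  refine le_antisymm (not_lt.1 fun hlt => ?_) (hl w)
  obtain ⟨c, r, hr⟩ : ∃ c r, (v w).drop n = c :: r :=
    List.exists_cons_of_ne_nil (by rw [Ne, List.drop_eq_nil_iff]; omega)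
  have hv : v w = (F w).toList ++ c :: r := by
    rw [← hr]; exact (List.take_append_drop n (v w)).symm
  obtain ⟨w', y, hw'⟩ := h.exists_eq (((F w).toList ++ (!c) :: []) ++ₛ Stream'.const true)
  have := hFi (hFs (F w) _ w' y (by rw [← hw', Stream'.append_append_stream]))
  rw [this, hv] at hw'
  exact append_cons_ne hw'.symm

/-- If some prefix gets shorter then some prefix gets longer. -/
theorem exists_length_lt (h : IsTable f v) {a} (ha : (v a).length < n) :
    ∃ d, n < (v d).length := by
  by_contra! hl
  -- Padding to length `n` is injective because the image cones are disjoint, hence onto. But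
  -- padding `v a` with `true` instead of `false` gives a word that is not attained.
  let F : List.Vector Bool n → List.Vector Bool n := fun w =>
    ⟨v w ++ List.replicate (n - (v w).length) false, by
      have := hl w; rw [List.length_append, List.length_replicate]; omega⟩
  have hF : Function.Injective F := fun w w' hw => by
    have := congrArg (fun l => l.toList ++ₛ Stream'.const true) hw
    simp only [F, List.Vector.toList, Stream'.append_append_stream] at this
    exact h.inj this
  obtain ⟨w, hw⟩ := Finite.injective_iff_surjective.1 hF
    ⟨v a ++ List.replicate (n - (v a).length) true, by
      have := hl a; rw [List.length_append, List.length_replicate]; omega⟩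
  have hw := congrArg List.Vector.toList hw
  simp only [F, List.Vector.toList] at hw
  have h1 := congrArg (fun l => l ++ₛ Stream'.const true) hw
  simp only [Stream'.append_append_stream] at h1
  have := h.inj h1
  subst this
  rw [List.append_cancel_left_eq, List.replicate_inj] at hw
  simp at hw
  omega

/-- An element of `V` that permutes the prefixes of a fixed length has finite order. -/
theorem hom_eq_one_of_length_eq (h : IsTable f v) (hl : ∀ w, (v w).length = n)
    (χ : ThompsonV →* Multiplicative ℤ) : χ f = 1 := by
  have hσ : ∀ k : ℕ, ∃ σ : List.Vector Bool n → List.Vector Bool n,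
      IsTable (f ^ k) fun w => (σ w).toList := by
    intro k
    induction k with
    | zero => exact ⟨id, fun w x => rfl⟩
    | succ k ih =>
      obtain ⟨σ, hσ⟩ := ih
      refine ⟨fun w => ⟨v (σ w), hl _⟩, fun w x => ?_⟩
      rw [pow_succ']
      change (f : Equiv.Perm (Stream' Bool)) (((f ^ k : ThompsonV) : Equiv.Perm (Stream' Bool)) _) = _
      rw [hσ]
      exact h _ _
  choose σ hσ using hσ
  obtain ⟨k, l, hkl, he⟩ := Finite.exists_ne_map_eq_of_infinite σ
  have hf : f ^ k = f ^ l := by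
    refine Subtype.ext (Equiv.ext fun x => ?_)
    have h1 := hσ k ⟨x.take n, Stream'.length_take n x⟩ (x.drop n)
    have h2 := hσ l ⟨x.take n, Stream'.length_take n x⟩ (x.drop n)
    rw [he, ← h2] at h1
    have h3 : List.Vector.toList ⟨x.take n, Stream'.length_take n x⟩ ++ₛ x.drop n = x :=
      Stream'.append_take_drop n x
    rwa [h3] at h1
  have := congrArg (fun g => (χ g).toAdd) hf
  simp only [map_pow, toAdd_pow, nsmul_eq_mul] at this
  have h0 : (χ f).toAdd = 0 := by
    by_contra h0
    exact hkl (by exact_mod_cast mul_right_cancel₀ h0 this)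
  exact toAdd_eq_zero.1 h0

/-- If some prefix gets shorter, then exchanging its image with the parent of a deepest
image produces a table of smaller total length. -/
theorem exists_coneSwap (h : IsTable f v) {a} (ha : (v a).length < n) :
    ∃ (τ : ThompsonV) (v' : List.Vector Bool n → List Bool), τ * τ = 1 ∧ IsTable (τ * f) v' ∧
      ∑ w, (v' w).length < ∑ w, (v w).length := by
  classical
  obtain ⟨d₀, hd₀⟩ := h.exists_length_lt ha
  have : Nonempty (List.Vector Bool n) := ⟨a⟩
  obtain ⟨d, hd⟩ := Finite.exists_max fun w => (v w).length
  have hdn : n < (v d).length := hd₀.trans_le (hd d₀)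
  obtain ⟨r, b, hrb⟩ : ∃ r b, v d = r ++ [b] :=
    ⟨(v d).dropLast, (v d).getLast (List.ne_nil_of_length_pos (by omega)),
      (List.dropLast_append_getLast _).symm⟩
  have hrl : (v d).length = r.length + 1 := by rw [hrb]; simp
  obtain ⟨e, y, he⟩ := h.exists_eq ((r ++ [!b]) ++ₛ Stream'.const true)
  -- The sibling of a deepest image is itself an image: a longer word contradicts maximality, and a
  -- shorter one would be a prefix of `v d`.
  have hve : v e = r ++ [!b] := by
    have hle := hd e
    rcases prefix_or_prefix_of_append_eq he with ⟨c, hc⟩ | ⟨c, hc⟩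
    · have hl := congrArg List.length hc
      simp only [List.length_append, List.length_singleton] at hl
      have : c = [] := List.length_eq_zero_iff.1 (by omega)
      rw [hc, this, List.append_nil]
    · rcases List.eq_nil_or_concat c with rfl | ⟨c', z, rfl⟩
      · rw [hc, List.append_nil]
      · exfalso
        rw [List.concat_eq_append, ← List.append_assoc] at hc
        have hr : r = v e ++ c' := (List.append_inj' hc rfl).1
        have := h.inj (w := d) (w' := e) (x := Stream'.const true)
          (y := (c' ++ [b]) ++ₛ Stream'.const true)
          (by rw [hrb, hr, List.append_assoc, Stream'.append_append_stream])
        subst this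
        have := congrArg List.length hr
        rw [List.length_append] at this
        omega
  have hel : (v e).length = r.length + 1 := by rw [hve]; simp
  have hcone : ∀ w x z, v w ++ₛ x = r ++ₛ z → w = d ∨ w = e := by
    intro w x z hz
    by_cases hb : z.head = b
    · left
      refine h.inj (x := x) (y := z.tail) ?_
      rw [hz, hrb, Stream'.append_append_stream, ← hb, Stream'.append_stream_head_tail]
    · right
      refine h.inj (x := x) (y := z.tail) ?_
      have hb : z.head = !b := by cases b <;> simpa using hb
      rw [hz, hve, Stream'.append_append_stream, ← hb, Stream'.append_stream_head_tail]
  have had : a ≠ d := by rintro rfl; omega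
  have hae : a ≠ e := by rintro rfl; omega
  have hde : d ≠ e := by
    rintro rfl
    rw [hrb, List.append_cancel_left_eq] at hve
    cases b <;> simp at hve
  have hdis : ∀ x y, v a ++ₛ x ≠ r ++ₛ y := fun x y hxy => (hcone a x y hxy).elim had hae
  -- The total length changes by `(v a).length - r.length`, which is negative because `(v a).length
  -- < n ≤ r.length`.
  let v' : List.Vector Bool n → List Bool := fun w =>
    if w = d then v a ++ [b] else if w = e then v a ++ [!b] else if w = a then r else v w
  refine ⟨coneSwap _ _ hdis, v', coneSwap_mul_self _ _ _, fun w x => ?_, ?_⟩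
  · change coneSwapFun (v a) r ((f : Equiv.Perm (Stream' Bool)) _) = _
    rw [h]
    by_cases hwd : w = d
    · subst hwd
      simp only [v', if_true]
      rw [hrb, Stream'.append_append_stream, Stream'.append_append_stream, coneSwapFun_right hdis]
    by_cases hwe : w = e
    · subst hwe
      simp only [v', if_neg hwd, if_true]
      rw [hve, Stream'.append_append_stream, Stream'.append_append_stream, coneSwapFun_right hdis]
    by_cases hwa : w = a
    · subst hwa
      simp only [v', if_neg hwd, if_neg hwe, if_true]
      exact coneSwapFun_left _ _ _
    simp only [v', if_neg hwd, if_neg hwe, if_neg hwa]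
    exact coneSwapFun_of_notMem (fun z hz => hwa (h.inj hz))
      fun z hz => (hcone w x z hz).elim hwd hwe
  · rw [← Finset.sum_add_sum_compl {d, e, a}, ← Finset.sum_add_sum_compl {d, e, a} fun w =>
      (v w).length]
    have hrest : ∑ w ∈ ({d, e, a} : Finset _)ᶜ, (v' w).length =
        ∑ w ∈ ({d, e, a} : Finset _)ᶜ, (v w).length := by
      refine Finset.sum_congr rfl fun w hw => ?_
      simp only [Finset.mem_compl, Finset.mem_insert, Finset.mem_singleton, not_or] at hw
      simp only [v', if_neg hw.1, if_neg hw.2.1, if_neg hw.2.2]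
    rw [hrest]
    have hsum : ∀ g : List.Vector Bool n → ℕ, ∑ w ∈ ({d, e, a} : Finset _), g w = g d + g e + g a :=
      fun g => by
        rw [Finset.sum_insert (by simp [hde, had.symm]), Finset.sum_insert (by simp [hae.symm]),
          Finset.sum_singleton, add_assoc]
    rw [hsum, hsum]
    simp only [v', if_true, if_neg hde.symm, if_neg had, if_neg hae, List.length_append,
      List.length_singleton]
    omega

end IsTable

/-- Induction on the total length of a table: while some prefix gets shorter, an involution,
invisible to `χ`, reduces the total; otherwise the element has finite order. -/
theorem hom_int_eq_one (χ : ThompsonV →* Multiplicative ℤ) : χ = 1 := by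
  have key : ∀ (m n : ℕ) (f : ThompsonV) (v : List.Vector Bool n → List Bool), IsTable f v →
      ∑ w, (v w).length = m → χ f = 1 := by
    intro m
    induction m using Nat.strong_induction_on with
    | _ m ih =>
      intro n f v h hm
      by_cases hl : ∀ w, n ≤ (v w).length
      · exact h.hom_eq_one_of_length_eq (h.length_eq_of_le hl) χ
      · push Not at hl
        obtain ⟨a, ha⟩ := hl
        obtain ⟨τ, v', hτ, h', hlt⟩ := h.exists_coneSwap ha
        have h1 := ih _ (hm ▸ hlt) n _ v' h' rfl
        have h2 : χ τ = 1 := by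
          have := congrArg (fun g => (χ g).toAdd) hτ
          simp only [map_mul, map_one, toAdd_mul, toAdd_one] at this
          exact toAdd_eq_zero.1 (by omega)
        rwa [map_mul, h2, one_mul] at h1
  ext1 f
  obtain ⟨n, hn⟩ := f.2
  choose v hv using hn
  exact key _ n f (fun w => v w.1 w.2) (fun w x => hv w.1 w.2 x) rfl

end ThompsonV

/-! ### Surjections between ladder groups -/

/-- A surjection from a finite power of `G ∗ G` onto `G ∗ G` factors through one coordinate. -/
theorem exists_factor_of_surjective {G ι : Type*} [Group G] [Nontrivial G] [Finite ι]
    [DecidableEq ι] (F : (ι → G ∗ G) →* G ∗ G) (hF : Function.Surjective F) :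
    ∃ b, ∀ x, F x = F (Pi.mulSingle b (x b)) := by
  -- `N b` and `M b` are the images of the `b`-th factor and of its complement: commuting normal
  -- subgroups with product `G ∗ G`. If no `M b` is trivial, all `N b` are, and `F` is trivial.
  let N : ι → Subgroup (G ∗ G) := fun b => (F.comp (MonoidHom.mulSingle (fun _ => G ∗ G) b)).range
  let M : ι → Subgroup (G ∗ G) := fun b =>
    (Pi.evalMonoidHom (fun _ : ι => G ∗ G) b).ker.map F
  have hdecomp : ∀ b (x : ι → G ∗ G),
      x * (Pi.mulSingle b (x b))⁻¹ ∈ (Pi.evalMonoidHom (fun _ : ι => G ∗ G) b).ker := by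
    intro b x
    simp [MonoidHom.mem_ker]
  have hNM : ∀ b, N b = ⊥ ∨ M b = ⊥ := by
    intro b
    have hN : (N b).Normal := ⟨by
      rintro _ ⟨x, rfl⟩ s
      obtain ⟨y, rfl⟩ := hF s
      refine ⟨y b * x * (y b)⁻¹, ?_⟩
      simp only [MonoidHom.comp_apply, ← map_mul, ← map_inv]
      congr 1
      ext c
      by_cases hc : c = b
      · subst hc; simp
      · simp [hc]⟩
    have hM : (M b).Normal := Subgroup.Normal.map inferInstance F hF
    refine eq_bot_or_eq_bot_of_commute ?_ ?_
    · rintro _ ⟨x, rfl⟩ _ ⟨y, hy, rfl⟩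
      rw [SetLike.mem_coe, MonoidHom.mem_ker, Pi.evalMonoidHom_apply] at hy
      refine Commute.map (funext fun c => ?_) F
      by_cases hc : c = b
      · subst hc; simp [hy]
      · simp [hc]
    · intro s
      obtain ⟨x, rfl⟩ := hF s
      refine ⟨F (Pi.mulSingle b (x b)), ⟨x b, rfl⟩, F ((Pi.mulSingle b (x b))⁻¹ * x),
        ⟨_, ?_, rfl⟩, by rw [← map_mul, mul_inv_cancel_left]⟩
      simp [MonoidHom.mem_ker]
  by_cases h : ∃ b, M b = ⊥
  · obtain ⟨b, hb⟩ := h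
    refine ⟨b, fun x => ?_⟩
    have : F (x * (Pi.mulSingle b (x b))⁻¹) ∈ M b := ⟨_, hdecomp b x, rfl⟩
    rwa [hb, Subgroup.mem_bot, map_mul, map_inv, mul_inv_eq_one] at this
  · exfalso
    push Not at h
    have hF1 : F = 1 := by
      refine MonoidHom.ext fun x => Subgroup.pi_mem_of_mulSingle_mem (H := F.ker) x fun b => ?_
      have : F (Pi.mulSingle b (x b)) ∈ N b := ⟨x b, rfl⟩
      rwa [(hNM b).resolve_right (h b), Subgroup.mem_bot] at this
    obtain ⟨p, hp⟩ := exists_ne (1 : G)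
    obtain ⟨x, hx⟩ := hF (Monoid.Coprod.inl p)
    rw [hF1, MonoidHom.one_apply] at hx
    exact hp (Monoid.Coprod.inl_injective (hx.symm.trans (map_one _).symm))

theorem hom_pi_groupS_int_eq_one {n : ℕ} (χ : (Fin n → GroupS) →* Multiplicative ℤ) : χ = 1 := by
  refine MonoidHom.ext fun x => Subgroup.pi_mem_of_mulSingle_mem (H := χ.ker) x fun b => ?_
  have : χ.comp (MonoidHom.mulSingle (fun _ => GroupS) b) = 1 := by
    refine Monoid.Coprod.hom_ext ?_ ?_
    · rw [ThompsonV.hom_int_eq_one (MonoidHom.comp _ _)]; rfl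
    · rw [ThompsonV.hom_int_eq_one (MonoidHom.comp _ _)]; rfl
  exact DFunLike.congr_fun this (x b)

instance : Nontrivial ThompsonV := by
  obtain ⟨v, hv⟩ := ThompsonV.exists_orderOf_eq ⟨2, Nat.prime_two⟩
  exact ⟨v, 1, by rintro rfl; simp at hv⟩

theorem prodPartialConj_zpow_apply (u : Nat.Primes → ThompsonV) (ω : ℕ → Nat.Primes) (n : ℕ)
    (k : ℤ) (x : Fin n → GroupS) (i : Fin n) :
    (prodPartialConj u ω n ^ k) x i = partialConj (u (ω i) ^ k) (x i) := by
  rw [← partialConj_zpow]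
  induction k using Int.induction_on generalizing x with
  | zero => rfl
  | succ k ih => rw [zpow_add_one, zpow_add_one, MulAut.mul_apply, MulAut.mul_apply, ih]; rfl
  | pred k ih => rw [zpow_sub_one, zpow_sub_one, MulAut.mul_apply, MulAut.mul_apply, ih]; rfl

open SemidirectProduct in
/-- The primes of a quotient ladder group occur among those of the ladder group. -/
theorem exists_prime_eq_of_surjective (u : Nat.Primes → ThompsonV)
    (hu : ∀ p : Nat.Primes, orderOf (u p) = p) {ω η : ℕ → Nat.Primes} {m n : ℕ}
    (f : LadderGroup u η m →* LadderGroup u ω n) (hf : Function.Surjective f) (a : Fin n) :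
    ∃ b : Fin m, η b = ω a := by
  have hr : ∀ x, (f (inl x)).right = 1 := fun x =>
    DFunLike.congr_fun (hom_pi_groupS_int_eq_one ((rightHom.comp f).comp inl)) x
  -- Multiplicative because `hr` removes the twist by the `ℤ`-coordinate.
  let F : (Fin m → GroupS) →* GroupS := MonoidHom.mk' (fun x => (f (inl x)).left a) fun x y => by
    rw [map_mul, map_mul, mul_left, hr, map_one]; rfl
  set e : ℤ := (f (inr (Multiplicative.ofAdd 1))).right.toAdd with he
  have hek : ∀ k : ℤ, (f (inr (Multiplicative.ofAdd k))).right.toAdd = e * k := fun k => by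
    have : Multiplicative.ofAdd k = Multiplicative.ofAdd 1 ^ k := by
      rw [← ofAdd_zsmul, smul_eq_mul, mul_one]
    rw [this, map_zpow, map_zpow]
    change (rightHom (f (inr (Multiplicative.ofAdd 1)) ^ k)).toAdd = _
    rw [map_zpow, toAdd_zpow, smul_eq_mul, mul_comm]
    rfl
  have hey : ∀ y, (f y).right.toAdd = e * y.right.toAdd := fun y => by
    rw [← hek, ofAdd_toAdd]
    conv_lhs => rw [← inl_left_mul_inr_right y, map_mul, mul_right, hr, one_mul]
  have he1 : IsUnit e := by
    obtain ⟨y, hy⟩ := hf (inr (Multiplicative.ofAdd 1))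
    have := hey y
    rw [hy, right_inr, toAdd_ofAdd] at this
    exact IsUnit.of_mul_eq_one _ this.symm
  have hF : Function.Surjective F := fun s => by
    obtain ⟨y, hy⟩ := hf (inl (Pi.mulSingle a s))
    have h1 := hey y
    rw [hy, right_inl, toAdd_one, eq_comm, mul_eq_zero, or_iff_right he1.ne_zero] at h1
    refine ⟨y.left, ?_⟩
    have h2 : inl y.left = y := by
      conv_rhs => rw [← inl_left_mul_inr_right y, toAdd_eq_zero.1 h1, map_one, mul_one]
    change (f (inl y.left)).left a = s
    rw [h2, hy, left_inl, Pi.mulSingle_eq_same]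
  obtain ⟨b, hb⟩ := exists_factor_of_surjective F hF
  refine ⟨b, ?_⟩
  set q : ℤ := ((η b : ℕ) : ℤ) with hq
  set c := f (inr (Multiplicative.ofAdd q)) with hc
  have hcr : c.right = Multiplicative.ofAdd (e * q) := hek q
  have hinner : ∀ s, partialConj (u (ω a) ^ (e * q)) s = (c.left a)⁻¹ * s * ((c.left a)⁻¹)⁻¹ := by
    intro s
    obtain ⟨x, rfl⟩ := hF s
    rw [hb]
    set y : Fin m → GroupS := Pi.mulSingle b (x b) with hy
    -- The other coordinates of `y` are 1, and on coordinate `b` the acting element has order `q`.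
    have hfix : (prodPartialConj u η m ^ q) y = y := by
      ext1 i
      rw [prodPartialConj_zpow_apply]
      by_cases hi : i = b
      · subst hi
        rw [hq, zpow_natCast, ← hu (η i), pow_orderOf_eq_one]
        exact DFunLike.congr_fun (partialConjHom_one (P := ThompsonV) (Q := ThompsonV)) _
      · rw [hy, Pi.mulSingle_eq_of_ne hi, map_one]
    have h1 := inl_aut (φ := zpowersHom _ (prodPartialConj u η m)) (Multiplicative.ofAdd q) y
    rw [zpowersHom_apply, toAdd_ofAdd, hfix, map_inv, eq_mul_inv_iff_mul_eq] at h1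
    have h2 := congrArg (fun z => (f z).left a) h1
    simp only [map_mul, mul_left] at h2
    rw [hr, map_one, ← hc, hcr] at h2
    have h3 : F y * c.left a = c.left a * partialConj (u (ω a) ^ (e * q)) (F y) := by
      refine h2.trans ?_
      rw [zpowersHom_apply, toAdd_ofAdd, Pi.mul_apply, prodPartialConj_zpow_apply]
      rfl
    rw [inv_inv, mul_assoc, h3, inv_mul_cancel_left]
  have h1 := eq_one_of_partialConj_inner ThompsonV.center_eq_bot hinner
  rw [← orderOf_dvd_iff_zpow_eq_one, hu, he1.dvd_mul_left, hq, Int.natCast_dvd_natCast] at h1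
  exact Subtype.ext ((Nat.prime_dvd_prime_iff_eq (ω a).2 (η b).2).1 h1).symm

/-! ### From pro-isomorphism to equality of ranges -/

theorem ladderBond_surjective (u : Nat.Primes → ThompsonV) (ω : ℕ → Nat.Primes) (n : ℕ) :
    Function.Surjective (ladderBond u ω n) := fun y =>
  ⟨⟨Fin.snoc y.left 1, y.right⟩, SemidirectProduct.ext
    (funext fun i => Fin.snoc_castSucc (α := fun _ => GroupS) 1 y.left i) rfl⟩

theorem bondComp_surjective {G : ℕ → Type*} [∀ n, Group (G n)] {α : ∀ n, G (n + 1) →* G n}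
    (hα : ∀ n, Function.Surjective (α n)) {m n : ℕ} (h : m ≤ n) :
    Function.Surjective (bondComp α h) := by
  induction n, h using Nat.le_induction with
  | base => rw [bondComp, Nat.leRec_self]; exact Function.surjective_id
  | succ n h ih => rw [bondComp, Nat.leRec_succ]; exact ih.comp (hα n)

theorem mainTheorem3 (u : Nat.Primes → ThompsonV) (hu : ∀ p : Nat.Primes, orderOf (u p) = p)
    (ω η : ℕ → Nat.Primes) (hω : StrictMono fun k => (ω k : ℕ))
    (hη : StrictMono fun k => (η k : ℕ)) (hne : ω ≠ η) :
    ¬ ProIsomorphic (ladderBond u ω) (ladderBond u η) := by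
  rintro ⟨i, j, hi, hj, f, g, hfg, hgf⟩
  have hf : ∀ k, Function.Surjective (f k) := fun k =>
    Function.Surjective.of_comp (g := g k) <| by
      rw [← MonoidHom.coe_comp, hfg]; exact bondComp_surjective (ladderBond_surjective u ω) _
  have hg : ∀ k, Function.Surjective (g k) := fun k =>
    Function.Surjective.of_comp (g := f (k + 1)) <| by
      rw [← MonoidHom.coe_comp, hgf]; exact bondComp_surjective (ladderBond_surjective u η) _
  have h : Set.range (fun k => (ω k : ℕ)) = Set.range fun k => (η k : ℕ) := by
    apply Set.Subset.antisymm
    · rintro _ ⟨k, rfl⟩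
      -- Level `k + 1` is far enough: `i (k + 1) ≥ k + 1`, so coordinate `k` is present.
      obtain ⟨b, hb⟩ := exists_prime_eq_of_surjective u hu (f (k + 1)) (hf _)
        ⟨k, Nat.lt_of_succ_le (hi.id_le (k + 1))⟩
      exact ⟨b, congrArg Subtype.val hb⟩
    · rintro _ ⟨k, rfl⟩
      obtain ⟨b, hb⟩ := exists_prime_eq_of_surjective u hu (g (k + 1)) (hg _)
        ⟨k, Nat.lt_of_succ_le (hj.id_le (k + 1))⟩
      exact ⟨b, congrArg Subtype.val hb⟩
  have := (hω.range_inj hη).1 h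
  exact hne (funext fun k => Subtype.ext (congrFun this k))
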